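/- Let $N\ge 1$ data streams be observed at times $t=1,2,\dots$; the observations $X^n_t$ ($1\le n\le N$, $t\ge1$) are independent with $X^n_t\sim N(\mu^n_t,1)$. Fix $\Delta\neq0$. For $1\le\nu<\infty$ and $\mathcal N\subset\{1,\dots,N\}$ let $P_{\nu,\mathcal N}$ be the law of the observations with $\mu^n_t=\Delta\mathbf 1_{\{t\ge\nu,\ n\in\mathcal N\}}$; let $P_\nu$ be the mixture of the $P_{\nu,\mathcal N}$ over a random set $\mathcal N$ that contains each stream independently with probability $\epsilon\in(0,1)$; and let $P_\infty$ be the law with all $\mu^n_t=0$. Expectations are denoted by $E$ with the same subscripts. For a stopping rule $T$ (a stopping time, possibly infinite, of the filtration generated by the observations) put $\mathrm{ARL}(T)=E_\infty T$, $$D_N(T)=\sup_{1\le\nu<\infty}E_\nu(T-\nu+1\mid T\ge\nu),\qquad D_N^{(V)}(T)=\sup_{1\le\nu<\infty}\ \max_{\#\mathcal N=V}E_{\nu,\mathcal N}(T-\nu+1\mid T\ge\nu),$$ where the suprema are over those $\nu$ for which the conditioning event has positive probability. Let $0<\zeta\le1$ and $0<\beta<1$, and let $\gamma=\gamma_N\ge1$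 and $\epsilon=\epsilon_N\in(0,1)$ satisfy $\log\gamma_N\sim N^{\zeta}$ and $\epsilon_N\sim N^{-\beta}$ as $N\to\infty$ (where $a_N\sim b_N$ means $a_N/b_N\to1$). For each $N$ let $T=T_N$ be any stopping rule with $\mathrm{ARL}(T_N)\ge\gamma_N$. (a) If $\frac{1-\zeta}{2}<\beta<1-\zeta$, then $$\liminf_{N\to\infty}\frac{D_N(T_N)}{\log N}\ \ge\ 2\Delta^{-2}\rho_Z(\beta,\zeta),$$ where $\rho_Z(\beta,\zeta)=\beta-\frac{1-\zeta}{2}$ if $\frac{1-\zeta}{2}<\beta\le\frac{3(1-\zeta)}{4}$, and $\rho_Z(\beta,\zeta)=\bigl(\sqrt{1-\zeta}-\sqrt{1-\zeta-\beta}\bigr)^2$ if $\frac{3(1-\zeta)}{4}<\beta\le1-\zeta$. (b) If $\beta>1-\zeta$ and $V=V_N\ge1$ are integers with $V_N=o(N^{\zeta}/\log N)$, then $$\liminf_{N\to\infty}\frac{V_N\,D_N^{(V_N)}(T_N)}{N^{\zeta}}\ \ge\ 2\Delta^{-2};$$ in particular, if $V$ is constant, $\liminf_{N\to\infty}D_N^{(V)}(T_N)/N^{\zeta}\ge2\Delta^{-2}V^{-1}$.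 -/

import Mathlib

open Filter Topology MeasureTheory ProbabilityTheory Asymptotics
open scoped ENNReal

noncomputable section

namespace SeqDetect

/-- Paths of the observations of `N` data streams at the times `1, 2, 3, …`. The coordinate `ω i n`
is the observation of stream `n` at time `i + 1`. -/
abbrev Path (N : ℕ) : Type := ℕ → Fin N → ℝ

/-- The law of the observations when there is no change: all of them are independent `N(0, 1)`. -/
def noChangeLaw (N : ℕ) : Measure (Path N) :=
  Measure.infinitePi fun _ : ℕ => Measure.pi fun _ : Fin N => gaussianReal 0 1

/-- The law of the observations when exactly the streams in `S` change at time `ν`: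
the observations are independent, and the one of stream `n` at time `t = i + 1` is `N(Δ, 1)` if
`n ∈ S` and `ν ≤ t`, and `N(0, 1)` otherwise. -/
def changeLaw (N : ℕ) (Δ : ℝ) (ν : ℕ) (S : Finset (Fin N)) : Measure (Path N) :=
  Measure.infinitePi fun i : ℕ => Measure.pi fun n : Fin N =>
    gaussianReal (if ν ≤ i + 1 ∧ n ∈ S then Δ else 0) 1

/-- The law of the observations when every stream, independently of the others, changes at time
`ν` with probability `ε`: the mixture of `changeLaw N Δ ν S` over the random set `S` that contains
each stream independently with probability `ε`. -/
def mixtureLaw (N : ℕ) (Δ ε : ℝ) (ν : ℕ) : Measure (Path N) :=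
  ∑ S : Finset (Fin N),
    ENNReal.ofReal (ε ^ S.card * (1 - ε) ^ (N - S.card)) • changeLaw N Δ ν S

/-- The filtration of the observations: at time `t` it is generated by the observations of all the
streams at the times `1, …, t` (the coordinates `0, …, t - 1` of the path). It is trivial at
time `0`. -/
def obsFiltration (N : ℕ) :
    Filtration ℕ (inferInstance : MeasurableSpace (Path N)) where
  seq t := ⨆ i ∈ Set.Iio t, MeasurableSpace.comap (fun ω : Path N => ω i) inferInstance
  mono' _ _ hst := biSup_mono fun _ hi => lt_of_lt_of_le hi hst
  le' _ := iSup₂_le fun i _ => (measurable_pi_apply i).comap_le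

/-- A stopping rule with respect to the observations; the value `⊤` means never stopping. -/
def IsStoppingRule {N : ℕ} (T : Path N → ℕ∞) : Prop :=
  IsStoppingTime (obsFiltration N) T

/-- The average run length to false alarm: the expectation of `T` when there is no change. -/
def arl {N : ℕ} (T : Path N → ℕ∞) : ℝ≥0∞ :=
  ∫⁻ ω, (T ω : ℝ≥0∞) ∂(noChangeLaw N)

/-- The conditional expectation of `T - ν + 1` given the event `T ≥ ν`, under the law `P`.
If that event is null, the value is `0`, so that such `ν` do not matter in a supremum. -/
def condDelay {N : ℕ} (P : Measure (Path N)) (T : Path N → ℕ∞) (ν : ℕ) : ℝ≥0∞ :=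
  ∫⁻ ω, ((T ω : ℝ≥0∞) - (ν : ℝ≥0∞) + 1) ∂(P[|{ω | (ν : ℕ∞) ≤ T ω}])

/-- The worst expected detection delay over all change times `ν ≥ 1`, when every stream changes
independently with probability `ε`. -/
def delay {N : ℕ} (Δ ε : ℝ) (T : Path N → ℕ∞) : ℝ≥0∞ :=
  ⨆ (ν : ℕ) (_ : 1 ≤ ν), condDelay (mixtureLaw N Δ ε ν) T ν

/-- The worst expected detection delay over all change times `ν ≥ 1` and all sets of exactly `V`
changing streams. -/
def delayOfSize {N : ℕ} (Δ : ℝ) (V : ℕ) (T : Path N → ℕ∞) : ℝ≥0∞ :=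
  ⨆ (ν : ℕ) (_ : 1 ≤ ν) (S : Finset (Fin N)) (_ : S.card = V),
    condDelay (changeLaw N Δ ν S) T ν

/-- The two-dimensional Donoho–Ingster–Jin constant, for `(1 - ζ) / 2 < β ≤ 1 - ζ`. -/
def rhoZ (β ζ : ℝ) : ℝ :=
  if β ≤ 3 * (1 - ζ) / 4 then β - (1 - ζ) / 2
  else (Real.sqrt (1 - ζ) - Real.sqrt (1 - ζ - β)) ^ 2

end SeqDetect

end

/-!
A stopping rule with a large average run length has a long window of times in which it is unlikely
to stop as long as nothing changes: if `E_∞ T ≥ γ`, then for every length `k` there is a time `a`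
with `P_∞(T > a) > 0` and `P_∞(T ≤ a + k | T > a) ≤ 2 k / γ`, since otherwise `T` would be dominated
by a geometric variable with mean `γ / 2` (`exists_window_le`).

Let the change happen at `ν = a + 1`. On the events observable by time `a + k` the law after the
change has a density `L` with respect to `P_∞`, which depends on the observations at the times
`a + 1, …, a + k` only and is therefore independent of `{T > a}`
(`changeLaw_apply_eq_setLIntegral`, `mixtureLaw_apply_eq_setLIntegral`,
`setLIntegral_eq_mul_of_measurable_future`). Hölder's inequality with an exponent `p > 1` gives
`P_ν(T ≤ a + k | T > a) ≤ (E_∞ L ^ p) ^ (1 / p) * (2 k / γ) ^ (1 - 1 / p)`,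
and the conditional delay is at least `k` times the probability of the complement
(`le_condDelay_of_density`). It remains to choose `k` and `p` such that `E_∞ L ^ p` is at most
`exp (θ N ^ ζ)` with `θ < p - 1`, while `γ = exp ((1 + o(1)) N ^ ζ)` and `log k = o(N ^ ζ)`
(`le_liminf_of_eventually_le`).

The likelihood ratio `Y` of a single stream has the moment `E Y ^ p = exp (p (p - 1) k Δ ^ 2 / 2)`.
For a fixed set of `V` streams, `E_∞ L ^ p` is its `V`-th power, and `p` close to `1` allows every
`k` with `k V Δ ^ 2 / 2 ≤ (1 - δ) N ^ ζ`. For the mixture, `L` is the product of the `N` independent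
factors `1 + ε (Y - 1)`. The inequality `(1 + u) ^ p ≤ 1 + p u + 2 |u| ^ p` for `1 < p ≤ 2` and
`E (Y - 1) = 0` bound `log E_∞ L ^ p` by a multiple of `N ε ^ p E Y ^ p`. With
`k Δ ^ 2 / 2 = ρ log N` this is `N ^ (1 - p β + p (p - 1) ρ)`, and minimizing over `p ∈ (1, 2]` shows
that it is `o(N ^ ζ)` for some `p` whenever `ρ < rhoZ β ζ` (`exists_order_of_lt_rhoZ`); the two
regimes of `rhoZ` correspond to a minimum at the end point `p = 2` and at an interior point.
-/

namespace SeqDetect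

/-! ### Likelihood ratios of Gaussian product measures -/

/-- The likelihood ratio of `N(Δ, 1)` against `N(0, 1)` at the point `x`. -/
noncomputable def gaussianLR (Δ x : ℝ) : ℝ≥0∞ := ENNReal.ofReal (Real.exp (Δ * x - Δ ^ 2 / 2))

@[fun_prop]
lemma measurable_gaussianLR (Δ : ℝ) : Measurable (gaussianLR Δ) := by
  unfold gaussianLR; fun_prop

lemma gaussianReal_withDensity_gaussianLR (Δ : ℝ) :
    (gaussianReal 0 1).withDensity (gaussianLR Δ) = gaussianReal Δ 1 := by
  rw [gaussianReal_of_var_ne_zero 0 one_ne_zero, gaussianReal_of_var_ne_zero Δ one_ne_zero,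
    ← withDensity_mul _ (measurable_gaussianPDF 0 1) (measurable_gaussianLR Δ)]
  congr 1
  ext x
  simp only [Pi.mul_apply, gaussianPDF, gaussianLR, gaussianPDFReal]
  rw [← ENNReal.ofReal_mul (by positivity), mul_assoc, ← Real.exp_add]
  congr 3
  simp only [NNReal.coe_one]
  ring

lemma lintegral_gaussianLR_rpow (Δ p : ℝ) :
    ∫⁻ x, gaussianLR Δ x ^ p ∂(gaussianReal 0 1) =
      ENNReal.ofReal (Real.exp (p * (p - 1) * Δ ^ 2 / 2)) := by
  have h1 : ∀ x, gaussianLR Δ x ^ p =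
      ENNReal.ofReal (Real.exp (-(p * Δ ^ 2 / 2)) * Real.exp (p * Δ * x)) := fun x => by
    rw [gaussianLR, ENNReal.ofReal_rpow_of_pos (Real.exp_pos _), ← Real.exp_mul, ← Real.exp_add]
    congr 2
    ring
  simp_rw [h1]
  rw [← ofReal_integral_eq_lintegral_ofReal ((integrable_exp_mul_gaussianReal _).const_mul _)
    (Eventually.of_forall fun x => by positivity), integral_const_mul]
  have h2 := congrFun (mgf_fun_id_gaussianReal (μ := 0) (v := 1)) (p * Δ)
  rw [mgf] at h2
  rw [h2, ← Real.exp_add]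
  congr 2
  simp only [NNReal.coe_one]
  ring

lemma lintegral_prod_infinitePi {ι : Type*} {X : ι → Type*} [∀ i, MeasurableSpace (X i)]
    (μ : (i : ι) → Measure (X i)) [∀ i, IsProbabilityMeasure (μ i)] {F : (i : ι) → X i → ℝ≥0∞}
    (hF : ∀ i, Measurable (F i)) (s : Finset ι) :
    ∫⁻ ω, ∏ i ∈ s, F i (ω i) ∂(Measure.infinitePi μ) = ∏ i ∈ s, ∫⁻ x, F i x ∂(μ i) := by
  refine (lintegral_prod_eq_prod_lintegral_of_indepFun s (fun i (ω : (i : ι) → X i) => F i (ω i))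
    (iIndepFun_infinitePi hF) fun i => (hF i).comp (measurable_pi_apply i)).trans
    (Finset.prod_congr rfl fun i _ => ?_)
  have h1 : (Measure.infinitePi μ).map (fun ω => ω i) = μ i := Measure.infinitePi_map_eval μ i
  have h2 := lintegral_map (μ := Measure.infinitePi μ) (hF i) (measurable_pi_apply i)
  rw [h1] at h2
  exact h2.symm

/-- Changing finitely many factors of a product measure by densities amounts to a density. -/
lemma infinitePi_withDensity_prod {ι : Type*} [DecidableEq ι] {X : ι → Type*}
    [∀ i, MeasurableSpace (X i)]
    (μ : (i : ι) → Measure (X i)) [∀ i, IsProbabilityMeasure (μ i)]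
    (μ' : (i : ι) → Measure (X i)) [∀ i, IsProbabilityMeasure (μ' i)]
    (f : (i : ι) → X i → ℝ≥0∞) (hf : ∀ i, Measurable (f i)) (I : Finset ι)
    (h : ∀ i ∈ I, μ' i = (μ i).withDensity (f i)) (h' : ∀ i ∉ I, μ' i = μ i) :
    (Measure.infinitePi μ).withDensity (fun ω => ∏ i ∈ I, f i (ω i)) =
      Measure.infinitePi μ' := by
  refine Measure.eq_infinitePi μ' fun s t ht => ?_
  have hms : MeasurableSet (Set.pi (s : Set ι) t) := MeasurableSet.pi s.countable_toSet fun i _ => ht i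
  rw [withDensity_apply _ hms, ← lintegral_indicator hms]
  -- The box and the density are combined into one product of functions of single coordinates.
  let G : (i : ι) → X i → ℝ≥0∞ := fun i =>
    Set.indicator (if i ∈ s then t i else Set.univ) (if i ∈ I then f i else 1)
  have hmt : ∀ i, MeasurableSet (if i ∈ s then t i else Set.univ) := fun i => by
    split_ifs
    exacts [ht i, .univ]
  have hG : ∀ i, Measurable (G i) := fun i => by
    refine Measurable.indicator ?_ (hmt i)
    split_ifs
    exacts [hf i, measurable_one]
  have h1 : ∀ ω, (Set.pi (s : Set ι) t).indicator (fun ω => ∏ i ∈ I, f i (ω i)) ω =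
      ∏ i ∈ s ∪ I, G i (ω i) := fun ω => by
    by_cases hω : ω ∈ Set.pi (s : Set ι) t
    · rw [Set.indicator_of_mem hω]
      have : ∀ i ∈ s ∪ I, G i (ω i) = if i ∈ I then f i (ω i) else 1 := fun i _ => by
        simp only [G]
        rw [Set.indicator_of_mem]
        · split_ifs <;> rfl
        · split_ifs with hi
          exacts [hω i hi, trivial]
      rw [Finset.prod_congr rfl this, Finset.prod_ite_mem,
        Finset.inter_eq_right.2 Finset.subset_union_right]
    · rw [Set.indicator_of_notMem hω]
      simp only [Set.mem_pi, not_forall] at hω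
      obtain ⟨i, hi, hit⟩ := hω
      refine (Finset.prod_eq_zero (Finset.mem_union_left _ hi) ?_).symm
      simp only [G]
      rw [Set.indicator_of_notMem]
      simpa [Finset.mem_coe.1 hi] using hit
  simp_rw [h1]
  rw [lintegral_prod_infinitePi μ hG]
  have h2 : ∀ i, ∫⁻ x, G i x ∂(μ i) = μ' i (if i ∈ s then t i else Set.univ) := fun i => by
    rw [lintegral_indicator (hmt i)]
    split_ifs with hs hI hI
    · rw [h i hI, withDensity_apply _ (ht i)]
    · simp [h' i hI]
    · rw [h i hI, withDensity_apply _ .univ]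
    · simp [h' i hI]
  rw [Finset.prod_congr rfl fun i _ => h2 i]
  refine (Finset.prod_subset Finset.subset_union_left fun i _ hi => ?_).symm.trans
    (Finset.prod_congr rfl fun i hi => by rw [if_pos hi])
  rw [if_neg hi, measure_univ]

/-- Product measures with the same factors at the times before `m` agree on the events that are
observable by time `m`. -/
lemma infinitePi_apply_eq_of_obsFiltration {N : ℕ} (μ μ' : ℕ → Measure (Fin N → ℝ))
    [∀ i, IsProbabilityMeasure (μ i)] [∀ i, IsProbabilityMeasure (μ' i)] {m : ℕ}
    (h : ∀ i < m, μ i = μ' i) {B : Set (Path N)} (hB : MeasurableSet[obsFiltration N m] B) :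
    Measure.infinitePi μ B = Measure.infinitePi μ' B := by
  have hle : obsFiltration N m ≤
      MeasurableSpace.comap (Finset.restrict (π := fun _ => Fin N → ℝ) (Finset.range m))
        inferInstance := by
    refine iSup₂_le fun i hi => ?_
    have : (fun ω : Path N => ω i) =
        (fun x : (j : Finset.range m) → Fin N → ℝ => x ⟨i, Finset.mem_range.2 hi⟩) ∘
          Finset.restrict (π := fun _ => Fin N → ℝ) (Finset.range m) := rfl
    rw [this, ← MeasurableSpace.comap_comp]
    exact MeasurableSpace.comap_mono (measurable_pi_apply _).comap_le
  obtain ⟨B', hB', rfl⟩ := hle _ hB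
  rw [← Measure.map_apply (by fun_prop) hB', ← Measure.map_apply (by fun_prop) hB',
    Measure.infinitePi_map_restrict, Measure.infinitePi_map_restrict]
  congr 2
  ext1 i
  exact h _ (Finset.mem_range.1 i.2)

instance (N : ℕ) : IsProbabilityMeasure (noChangeLaw N) := by
  unfold noChangeLaw; infer_instance

instance (N : ℕ) (Δ : ℝ) (ν : ℕ) (S : Finset (Fin N)) :
    IsProbabilityMeasure (changeLaw N Δ ν S) := by
  unfold changeLaw; infer_instance

/-- The likelihood ratio of a change in stream `n`, from the coordinates `a, …, b - 1` of the path,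
that is, from the observations at the times `a + 1, …, b`. -/
noncomputable def streamLR {N : ℕ} (Δ : ℝ) (a b : ℕ) (n : Fin N) (ω : Path N) : ℝ≥0∞ :=
  ∏ i ∈ Finset.Ico a b, gaussianLR Δ (ω i n)

@[fun_prop]
lemma measurable_streamLR {N : ℕ} (Δ : ℝ) (a b : ℕ) (n : Fin N) :
    Measurable (streamLR Δ a b n) := by
  unfold streamLR; fun_prop

/-- Change of measure: on the events observable by time `m`, the density of `changeLaw` with respect
to `noChangeLaw` is the product of the likelihood ratios of the changing streams from time `ν` on. -/
lemma changeLaw_apply_eq_setLIntegral {N : ℕ} (Δ : ℝ) {ν m : ℕ} (hν : 1 ≤ ν)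
    (S : Finset (Fin N)) {B : Set (Path N)} (hB : MeasurableSet[obsFiltration N m] B) :
    changeLaw N Δ ν S B = ∫⁻ ω in B, ∏ n ∈ S, streamLR Δ (ν - 1) m n ω ∂(noChangeLaw N) := by
  -- `μ'` has the factors of `changeLaw` before time `m` and those of `noChangeLaw` afterwards, so
  -- that it differs from `noChangeLaw` in finitely many factors only.
  let μ' : ℕ → Measure (Fin N → ℝ) := fun i => Measure.pi fun n : Fin N =>
    gaussianReal (if (ν ≤ i + 1 ∧ i < m) ∧ n ∈ S then Δ else 0) 1
  have h1 : changeLaw N Δ ν S B = Measure.infinitePi μ' B := by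
    refine infinitePi_apply_eq_of_obsFiltration _ _ (fun i hi => ?_) hB
    simp [μ', hi]
  have h2 : (noChangeLaw N).withDensity
      (fun ω => ∏ i ∈ Finset.Ico (ν - 1) m, ∏ n ∈ S, gaussianLR Δ (ω i n)) =
        Measure.infinitePi μ' := by
    refine infinitePi_withDensity_prod _ μ' (fun _ x => ∏ n ∈ S, gaussianLR Δ (x n))
      (fun _ => by fun_prop) _ (fun i hi => ?_) fun i hi => ?_
    · have hi' : ν ≤ i + 1 ∧ i < m := by rw [Finset.mem_Ico] at hi; omega
      simp only [μ', ← Measure.infinitePi_eq_pi]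
      refine (infinitePi_withDensity_prod _ _ (fun _ => gaussianLR Δ)
        (fun _ => measurable_gaussianLR Δ) S (fun n hn => ?_) fun n hn => ?_).symm
      · rw [if_pos ⟨hi', hn⟩, gaussianReal_withDensity_gaussianLR]
      · rw [if_neg fun h => hn h.2]
    · have hi' : ¬ (ν ≤ i + 1 ∧ i < m) := by rw [Finset.mem_Ico] at hi; omega
      simp [μ', hi']
  rw [h1, ← h2, withDensity_apply _ ((obsFiltration N).le m _ hB)]
  simp only [streamLR]
  simp_rw [Finset.prod_comm (s := S)]

/-- The likelihood ratio of the mixture law from the coordinates `a, …, b - 1` of the path. It is a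
product over the streams because each stream changes independently of the others. -/
noncomputable def mixtureLR {N : ℕ} (Δ ε : ℝ) (a b : ℕ) (ω : Path N) : ℝ≥0∞ :=
  ∏ n : Fin N, (ENNReal.ofReal ε * streamLR Δ a b n ω + ENNReal.ofReal (1 - ε))

lemma mixtureLaw_apply_eq_setLIntegral {N : ℕ} (Δ : ℝ) {ε : ℝ} (hε : 0 ≤ ε) (hε1 : ε ≤ 1)
    {ν m : ℕ} (hν : 1 ≤ ν) {B : Set (Path N)} (hB : MeasurableSet[obsFiltration N m] B) :
    mixtureLaw N Δ ε ν B = ∫⁻ ω in B, mixtureLR Δ ε (ν - 1) m ω ∂(noChangeLaw N) := by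
  have h1 : ∀ ω : Path N, mixtureLR Δ ε (ν - 1) m ω = ∑ S : Finset (Fin N),
      ENNReal.ofReal (ε ^ S.card * (1 - ε) ^ (N - S.card)) *
        ∏ n ∈ S, streamLR Δ (ν - 1) m n ω := fun ω => by
    rw [mixtureLR, Finset.prod_add, Finset.powerset_univ]
    refine Finset.sum_congr rfl fun S _ => ?_
    rw [Finset.prod_mul_distrib, Finset.prod_const, Finset.prod_const,
      ENNReal.ofReal_mul (by positivity), ENNReal.ofReal_pow hε, ENNReal.ofReal_pow (by linarith),
      Finset.card_sdiff_of_subset (Finset.subset_univ S), Finset.card_univ, Fintype.card_fin]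
    ring
  simp_rw [h1]
  rw [lintegral_finsetSum _ fun S _ => by fun_prop, mixtureLaw, Measure.finsetSum_apply]
  refine Finset.sum_congr rfl fun S _ => ?_
  rw [lintegral_const_mul _ (by fun_prop), Measure.smul_apply, smul_eq_mul,
    changeLaw_apply_eq_setLIntegral Δ hν S hB]

/-- Exchanging the roles of streams and times: the paths of the streams are i.i.d. -/
lemma noChangeLaw_map_swap (N : ℕ) :
    (noChangeLaw N).map (fun ω n i => ω i n) =
      Measure.infinitePi fun _ : Fin N => Measure.infinitePi fun _ : ℕ => gaussianReal 0 1 := by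
  have hlaw : noChangeLaw N = Measure.infinitePi fun _ : ℕ => Measure.infinitePi
      fun _ : Fin N => gaussianReal 0 1 := by
    simp_rw [noChangeLaw, Measure.infinitePi_eq_pi]
  have h1 : iIndepFun (fun (q : Fin N × ℕ) (ω : Path N) => ω q.2 q.1) (noChangeLaw N) := by
    have := iIndepFun_uncurry_infinitePi' (ι := ℕ) (κ := Fin N) (X := fun _ _ x => x)
      (fun _ _ => gaussianReal 0 1) (fun _ _ => measurable_id)
    rw [hlaw]
    exact this.precomp (g := Prod.swap) Prod.swap_injective
  rw [iIndepFun_iff_map_fun_eq_infinitePi_map (by fun_prop)] at h1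
  have h2 : ∀ q : Fin N × ℕ, (noChangeLaw N).map (fun ω => ω q.2 q.1) = gaussianReal 0 1 :=
    fun q => by
      have : (fun ω : Path N => ω q.2 q.1) = (fun x : Fin N → ℝ => x q.1) ∘ fun ω => ω q.2 := rfl
      rw [this, ← Measure.map_map (by fun_prop) (by fun_prop), hlaw]
      have e1 := Measure.infinitePi_map_eval
        (fun _ : ℕ => Measure.infinitePi fun _ : Fin N => gaussianReal 0 1) q.2
      have e2 := Measure.infinitePi_map_eval (fun _ : Fin N => gaussianReal 0 1) q.1
      rw [e1, e2]
  simp_rw [h2] at h1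
  rw [← Measure.infinitePi_map_curry (fun (_ : Fin N) (_ : ℕ) => gaussianReal 0 1), ← h1,
    Measure.map_map (by fun_prop) (by fun_prop)]
  rfl

lemma lintegral_prod_streamLR {N : ℕ} (Δ : ℝ) (a b : ℕ) (S : Finset (Fin N)) {h : ℝ≥0∞ → ℝ≥0∞}
    (hh : Measurable h) :
    ∫⁻ ω, ∏ n ∈ S, h (streamLR Δ a b n ω) ∂(noChangeLaw N) =
      (∫⁻ x, h (∏ i ∈ Finset.Ico a b, gaussianLR Δ (x i))
        ∂(Measure.infinitePi fun _ : ℕ => gaussianReal 0 1)) ^ S.card := by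
  let H : (ℕ → ℝ) → ℝ≥0∞ := fun x => h (∏ i ∈ Finset.Ico a b, gaussianLR Δ (x i))
  have hH : Measurable H := by fun_prop
  have h1 : ∫⁻ ω, ∏ n ∈ S, h (streamLR Δ a b n ω) ∂(noChangeLaw N) =
      ∫⁻ y, ∏ n ∈ S, H (y n) ∂((noChangeLaw N).map (fun ω n i => ω i n)) := by
    rw [lintegral_map (by fun_prop) (by fun_prop)]
    rfl
  rw [h1, noChangeLaw_map_swap, lintegral_prod_infinitePi _ (F := fun _ => H) fun _ => hH,
    Finset.prod_const]

lemma lintegral_prod_gaussianLR_rpow (Δ : ℝ) {p : ℝ} (hp : 0 ≤ p) (a b : ℕ) :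
    ∫⁻ x, (∏ i ∈ Finset.Ico a b, gaussianLR Δ (x i)) ^ p
        ∂(Measure.infinitePi fun _ : ℕ => gaussianReal 0 1) =
      ENNReal.ofReal (Real.exp (p * (p - 1) * Δ ^ 2 / 2 * (b - a : ℕ))) := by
  simp_rw [← ENNReal.prod_rpow_of_nonneg hp]
  rw [lintegral_prod_infinitePi _ (F := fun _ x => gaussianLR Δ x ^ p) fun _ => by fun_prop]
  simp_rw [lintegral_gaussianLR_rpow]
  rw [Finset.prod_const, Nat.card_Ico, ← ENNReal.ofReal_pow (by positivity), ← Real.exp_nat_mul]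
  congr 2
  ring

/-! ### A quiet window, and the delay by Hölder's inequality -/

/-- `T` is at most `k` times the number of `j` with `T > j k`. -/
lemma coe_le_tsum_indicator {Ω : Type*} (T : Ω → ℕ∞) {k : ℕ} (hk : 1 ≤ k) (ω : Ω) :
    (T ω : ℝ≥0∞) ≤ ∑' j : ℕ, (k : ℝ≥0∞) * {ω | T ω ≤ (j * k : ℕ)}ᶜ.indicator 1 ω := by
  cases hT : T ω with
  | top =>
    have h1 : ∀ j : ℕ, (k : ℝ≥0∞) * {ω | T ω ≤ (j * k : ℕ)}ᶜ.indicator 1 ω = k := fun j => by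
      rw [Set.indicator_of_mem (by
        simp only [Set.mem_compl_iff, Set.mem_ofPred_eq, hT, not_le]
        exact ENat.natCast_lt_top _)]
      simp
    simp_rw [h1]
    rw [ENNReal.tsum_const_eq_top_of_ne_zero (by simp; omega)]
    exact le_top
  | coe n =>
    have h1 : ∀ j ∈ Finset.range ((n + k - 1) / k),
        (k : ℝ≥0∞) * {ω | T ω ≤ (j * k : ℕ)}ᶜ.indicator 1 ω = k := fun j hj => by
      have hj' : j * k < n := by
        have h2 := Nat.mul_le_of_le_div k (j + 1) (n + k - 1) (Finset.mem_range.1 hj)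
        rw [add_mul, one_mul] at h2
        omega
      rw [Set.indicator_of_mem (by
        simp only [Set.mem_compl_iff, Set.mem_ofPred_eq, hT, not_le]
        exact Nat.cast_lt.2 hj')]
      simp
    refine le_trans ?_ (ENNReal.sum_le_tsum (Finset.range ((n + k - 1) / k)))
    rw [Finset.sum_congr rfl h1, Finset.sum_const, Finset.card_range, nsmul_eq_mul]
    have h3 : n ≤ (n + k - 1) / k * k := by
      have := Nat.lt_div_mul_add (a := n + k - 1) (b := k) (by omega)
      omega
    simpa using (Nat.cast_le (α := ℝ≥0∞)).2 h3

/-- If the mean of `T` is at least `γ`, some window of length `k` has a conditional probability of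
at most `2 k / γ` to contain `T`: otherwise `T` would be dominated by a geometric variable. -/
lemma exists_window_le {Ω : Type*} [MeasurableSpace Ω] (P : Measure Ω) [IsProbabilityMeasure P]
    (T : Ω → ℕ∞) (hT : ∀ t : ℕ, MeasurableSet {ω | T ω ≤ t}) {γ : ℝ} (hγ : 0 < γ)
    (hE : ENNReal.ofReal γ ≤ ∫⁻ ω, (T ω : ℝ≥0∞) ∂P) {k : ℕ} (hk : 1 ≤ k) :
    ∃ a : ℕ, P {ω | T ω ≤ a}ᶜ ≠ 0 ∧ P ({ω | T ω ≤ a}ᶜ ∩ {ω | T ω ≤ (a + k : ℕ)}) ≤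
      ENNReal.ofReal (2 * k / γ) * P {ω | T ω ≤ a}ᶜ := by
  by_contra! hcon
  set r : ℝ≥0∞ := ENNReal.ofReal (2 * k / γ) with hr
  have hk0 : (0 : ℝ) < k := by exact_mod_cast hk
  have hsum : ∫⁻ ω, (T ω : ℝ≥0∞) ∂P ≤ ∑' j : ℕ, (k : ℝ≥0∞) * P {ω | T ω ≤ (j * k : ℕ)}ᶜ := by
    refine (lintegral_mono (coe_le_tsum_indicator T hk)).trans_eq ?_
    rw [lintegral_tsum fun j => ((measurable_one.indicator (hT _).compl).const_mul _).aemeasurable]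
    refine tsum_congr fun j => ?_
    rw [lintegral_const_mul _ (measurable_one.indicator (hT _).compl),
      lintegral_indicator_one (hT _).compl]
  have hstep : ∀ a : ℕ, P {ω | T ω ≤ (a + k : ℕ)}ᶜ ≤ (1 - r) * P {ω | T ω ≤ a}ᶜ := fun a => by
    have hsub : {ω | T ω ≤ (a + k : ℕ)}ᶜ ⊆ {ω | T ω ≤ a}ᶜ := by
      refine Set.compl_subset_compl.2 fun ω (h : T ω ≤ a) => ?_
      exact le_trans h (Nat.cast_le.2 (Nat.le_add_right a k))
    by_cases h0 : P {ω | T ω ≤ a}ᶜ = 0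
    · rw [h0, mul_zero, measure_mono_null hsub h0]
    · rw [ENNReal.sub_mul fun _ _ => measure_ne_top _ _, one_mul]
      refine ENNReal.le_sub_of_add_le_right (by finiteness) ?_
      have hsplit := measure_inter_add_sdiff (μ := P) {ω | T ω ≤ a}ᶜ (hT (a + k))
      rw [add_comm] at hsplit
      refine le_trans ?_ hsplit.le
      exact add_le_add (measure_mono fun ω h => ⟨hsub h, h⟩) (hcon a h0).le
  -- For `r ≥ 1` the truncated difference `1 - r` is `0` and the geometric series has the value `1`
  -- instead of `r⁻¹`; then `T` would vanish almost surely.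
  rcases le_or_gt 1 r with h1 | h1
  · have h0 : P {ω | T ω ≤ (0 : ℕ)}ᶜ = 0 := by
      by_contra h0
      refine absurd (hcon 0 h0) (not_lt.2 ?_)
      exact (measure_mono Set.inter_subset_left).trans (le_mul_of_one_le_left' h1)
    have hj : ∀ j : ℕ, (k : ℝ≥0∞) * P {ω | T ω ≤ (j * k : ℕ)}ᶜ = 0 := fun j => by
      rw [measure_mono_null _ h0, mul_zero]
      refine Set.compl_subset_compl.2 fun ω (h : T ω ≤ (0 : ℕ)) => ?_
      exact le_trans h (Nat.cast_le.2 (Nat.zero_le _))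
    simp_rw [hj] at hsum
    rw [tsum_zero] at hsum
    exact absurd (hE.trans hsum) (not_le.2 (by simpa using hγ))
  · have hj : ∀ j : ℕ, P {ω | T ω ≤ (j * k : ℕ)}ᶜ ≤ (1 - r) ^ j := fun j => by
      induction j with
      | zero => simpa using prob_le_one
      | succ j ih =>
        rw [add_mul, one_mul, pow_succ']
        exact (hstep _).trans (by gcongr)
    have h2 : ∫⁻ ω, (T ω : ℝ≥0∞) ∂P ≤ ENNReal.ofReal (γ / 2) := by
      refine hsum.trans ((ENNReal.tsum_le_tsum fun j => mul_le_mul_right (hj j) _).trans_eq ?_)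
      rw [ENNReal.tsum_mul_left, ENNReal.tsum_geometric,
        ENNReal.sub_sub_cancel ENNReal.one_ne_top h1.le, hr,
        ← ENNReal.ofReal_inv_of_pos (by positivity), ← ENNReal.ofReal_natCast,
        ← ENNReal.ofReal_mul (by positivity)]
      congr 1
      field_simp
    refine absurd (hE.trans h2) (not_le.2 ?_)
    exact (ENNReal.ofReal_lt_ofReal_iff hγ).2 (by linarith)

/-- The functionals of the observations after time `a` are independent of the events observable by
time `a`. -/
lemma setLIntegral_eq_mul_of_measurable_future {N a : ℕ} {A : Set (Path N)}
    (hA : MeasurableSet[obsFiltration N a] A) {Z : Path N → ℝ≥0∞}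
    (hZ : Measurable[⨆ i ∈ Set.Ici a, MeasurableSpace.comap (fun ω : Path N => ω i) inferInstance]
      Z) :
    ∫⁻ ω in A, Z ω ∂(noChangeLaw N) = noChangeLaw N A * ∫⁻ ω, Z ω ∂(noChangeLaw N) := by
  have hle : ∀ i : ℕ, MeasurableSpace.comap (fun ω : Path N => ω i) inferInstance ≤
      (inferInstance : MeasurableSpace (Path N)) := fun i => (measurable_pi_apply i).comap_le
  have hind : Indep (obsFiltration N a)
      (⨆ i ∈ Set.Ici a, MeasurableSpace.comap (fun ω : Path N => ω i) inferInstance)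
      (noChangeLaw N) := by
    refine indep_iSup_of_disjoint hle ?_ (S := Set.Iio a) (T := Set.Ici a) ?_
    · exact iIndepFun_infinitePi (X := fun _ x => x) fun _ => measurable_id
    · exact Set.disjoint_left.2 fun i (hi : i < a) (hi' : a ≤ i) => not_le.2 hi hi'
  have hAm := (obsFiltration N).le a _ hA
  have hAi : Measurable[obsFiltration N a] (A.indicator (1 : Path N → ℝ≥0∞)) :=
    (measurable_indicator_const_iff (m := obsFiltration N a) (1 : ℝ≥0∞)).2 hA
  rw [← lintegral_indicator hAm, ← lintegral_indicator_one hAm,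
    ← lintegral_mul_eq_lintegral_mul_lintegral_of_independent_measurableSpace
      ((obsFiltration N).le a) (iSup₂_le fun i _ => hle i) hind hAi hZ]
  refine lintegral_congr fun ω => ?_
  by_cases h : ω ∈ A <;> simp [h]

/-- The likelihood ratio from the observations after time `a` depends on these only. -/
lemma measurable_future_streamLR {N : ℕ} (Δ : ℝ) (a b : ℕ) (n : Fin N) :
    Measurable[⨆ i ∈ Set.Ici a, MeasurableSpace.comap (fun ω : Path N => ω i) inferInstance]
      (streamLR Δ a b n) := by
  unfold streamLR
  refine @Finset.measurable_fun_prod _ _ _ _ _ _ (_) _ _ fun i hi => ?_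
  have h1 : Measurable[MeasurableSpace.comap (fun ω : Path N => ω i) inferInstance]
      (fun ω : Path N => gaussianLR Δ (ω i n)) :=
    Measurable.comp (g := fun x : Fin N → ℝ => gaussianLR Δ (x n)) (by fun_prop)
      (comap_measurable fun ω : Path N => ω i)
  exact h1.mono (le_iSup₂ (f := fun i (_ : i ∈ Set.Ici a) =>
    MeasurableSpace.comap (fun ω : Path N => ω i) inferInstance) i (Finset.mem_Ico.1 hi).1) le_rfl

/-- The lower bound for the delay by Hölder's inequality. Here `L` is the likelihood ratio of `Q`
over the window of the times `a + 1, …, a + k`, which is unlikely to contain `T` when there is no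
change. If its `p`-th moment is not too large, then `T` is unlikely to lie in the window under `Q`
as well, and outside of the window the delay exceeds `k`. -/
lemma le_condDelay_of_density {N : ℕ} (Q : Measure (Path N)) [IsProbabilityMeasure Q]
    {T : Path N → ℕ∞} (hT : IsStoppingRule T) {a k : ℕ} {L : Path N → ℝ≥0∞} (hL : Measurable L)
    (hQA : Q {ω | T ω ≤ a}ᶜ = noChangeLaw N {ω | T ω ≤ a}ᶜ)
    (hQB : Q ({ω | T ω ≤ a}ᶜ ∩ {ω | T ω ≤ (a + k : ℕ)}) =
      ∫⁻ ω in {ω | T ω ≤ a}ᶜ ∩ {ω | T ω ≤ (a + k : ℕ)}, L ω ∂(noChangeLaw N))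
    {p x y : ℝ} (hp : 1 < p)
    (hLp : ∫⁻ ω in {ω | T ω ≤ a}ᶜ, L ω ^ p ∂(noChangeLaw N) ≤
      noChangeLaw N {ω | T ω ≤ a}ᶜ * ENNReal.ofReal (Real.exp x))
    (h0 : noChangeLaw N {ω | T ω ≤ a}ᶜ ≠ 0)
    (hwin : noChangeLaw N ({ω | T ω ≤ a}ᶜ ∩ {ω | T ω ≤ (a + k : ℕ)}) ≤
      ENNReal.ofReal (Real.exp y) * noChangeLaw N {ω | T ω ≤ a}ᶜ) :
    ENNReal.ofReal (k * (1 - Real.exp (x / p + y * (1 - 1 / p)))) ≤ condDelay Q T (a + 1) := by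
  have hTm : ∀ t : ℕ, MeasurableSet {ω | T ω ≤ t} := fun t => (obsFiltration N).le t _ (hT t)
  set A := {ω | T ω ≤ a}ᶜ with hA
  set C := {ω | T ω ≤ (a + k : ℕ)} with hC
  set P := noChangeLaw N with hP
  have hAm : MeasurableSet A := (hTm a).compl
  have hCm : MeasurableSet C := hTm (a + k)
  have hpq : p.HolderConjugate (Real.conjExponent p) := Real.HolderConjugate.conjExponent hp
  have hq : 1 / Real.conjExponent p = 1 - 1 / p := by
    rw [one_div, one_div, ← hpq.inv_add_inv_eq_one]; ring
  have hp0 : 0 < p := by linarith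
  have hq0 : 0 ≤ 1 - 1 / p := by rw [← hq]; exact one_div_nonneg.2 hpq.symm.nonneg
  have hholder : Q (A ∩ C) ≤ P A * ENNReal.ofReal (Real.exp (x / p + y * (1 - 1 / p))) := by
    have h1 := ENNReal.lintegral_mul_le_Lp_mul_Lq (P.restrict A) hpq hL.aemeasurable
      (measurable_one.indicator hCm : Measurable (C.indicator (1 : Path N → ℝ≥0∞))).aemeasurable
    have h2 : ∫⁻ ω in A, (L * C.indicator (1 : Path N → ℝ≥0∞)) ω ∂P = Q (A ∩ C) := by
      rw [hQB, Set.inter_comm, ← setLIntegral_indicator hCm]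
      refine lintegral_congr fun ω => ?_
      by_cases h : ω ∈ C <;> simp [h]
    have h3 : ∫⁻ ω in A, (C.indicator (1 : Path N → ℝ≥0∞) ω) ^ Real.conjExponent p ∂P =
        P (A ∩ C) := by
      rw [Set.inter_comm, ← Measure.restrict_apply hCm, ← lintegral_indicator_one hCm]
      refine lintegral_congr fun ω => ?_
      by_cases h : ω ∈ C <;> simp [h, hpq.symm.pos]
    rw [h2, h3, hq] at h1
    calc Q (A ∩ C) ≤ _ := h1
      _ ≤ (P A * ENNReal.ofReal (Real.exp x)) ^ (1 / p) *
          (ENNReal.ofReal (Real.exp y) * P A) ^ (1 - 1 / p) := by gcongr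
      _ = P A ^ (1 / p + (1 - 1 / p)) * (ENNReal.ofReal (Real.exp x) ^ (1 / p) *
          ENNReal.ofReal (Real.exp y) ^ (1 - 1 / p)) := by
        rw [ENNReal.mul_rpow_of_nonneg _ _ (by positivity), ENNReal.mul_rpow_of_nonneg _ _ hq0,
          ENNReal.rpow_add_of_nonneg _ _ (by positivity) hq0]
        ring
      _ = _ := by
        rw [ENNReal.ofReal_rpow_of_pos (Real.exp_pos _), ENNReal.ofReal_rpow_of_pos (Real.exp_pos _),
          ← ENNReal.ofReal_mul (by positivity), ← Real.exp_mul, ← Real.exp_mul, ← Real.exp_add,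
          mul_one_div]
        simp
  have hset : {ω | ((a + 1 : ℕ) : ℕ∞) ≤ T ω} = A := by
    ext ω
    simp only [hA, Set.mem_ofPred_eq, Set.mem_compl_iff, not_le, Nat.cast_add, Nat.cast_one]
    exact ENat.add_one_le_iff (ENat.natCast_ne_top a)
  rw [condDelay, hset]
  have hcp : IsProbabilityMeasure (Q[|A]) := cond_isProbabilityMeasure (by rwa [hQA])
  have hcC : Q[|A] C ≤ ENNReal.ofReal (Real.exp (x / p + y * (1 - 1 / p))) := by
    rw [cond_apply hAm, hQA]
    calc (P A)⁻¹ * Q (A ∩ C) ≤ (P A)⁻¹ * (P A * _) := by gcongr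
      _ = _ := by rw [← mul_assoc, ENNReal.inv_mul_cancel h0 (by finiteness), one_mul]
  calc ENNReal.ofReal (k * (1 - Real.exp (x / p + y * (1 - 1 / p))))
      = k * (1 - ENNReal.ofReal (Real.exp (x / p + y * (1 - 1 / p)))) := by
        rw [ENNReal.ofReal_mul (by positivity), ENNReal.ofReal_natCast,
          ENNReal.ofReal_sub _ (by positivity), ENNReal.ofReal_one]
    _ ≤ k * (1 - Q[|A] C) := by gcongr
    _ = ∫⁻ ω, Cᶜ.indicator (fun _ => (k : ℝ≥0∞)) ω ∂(Q[|A]) := by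
        rw [lintegral_indicator_const hCm.compl, prob_compl_eq_one_sub hCm]
    _ ≤ _ := by
        refine lintegral_mono fun ω => ?_
        by_cases h : ω ∈ C
        · simp [h]
        · simp only [Set.mem_compl_iff, h, not_false_eq_true, Set.indicator_of_mem]
          have h1 : ((a + k : ℕ) : ℕ∞) ≤ T ω := by
            simp only [hC, Set.mem_ofPred_eq, not_le] at h
            exact h.le
          have h2 : ((a + k : ℕ) : ℝ≥0∞) ≤ (T ω : ℝ≥0∞) := by
            have := ENat.toENNReal_le.2 h1
            simpa using this
          calc (k : ℝ≥0∞) = ((a + k : ℕ) : ℝ≥0∞) - (a : ℕ) := by simp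
            _ ≤ (T ω : ℝ≥0∞) - (a : ℕ) := by gcongr
            _ ≤ _ := by
              push_cast
              rw [tsub_add_eq_tsub_tsub]
              exact le_tsub_add

/-! ### Moments of the likelihood ratios and non-asymptotic bounds for the delay -/

/-- The term of first order has mean zero for a centred `u`, which is why the mixture over a sparse
set of streams has a moment close to `1`. -/
lemma one_add_rpow_le {p u : ℝ} (hp : 1 < p) (hp2 : p ≤ 2) (hu : -1 ≤ u) :
    (1 + u) ^ p ≤ 1 + p * u + 2 * |u| ^ p := by
  have hp' : (1 + u) ^ p = (1 + u) * (1 + u) ^ (p - 1) := by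
    rw [← Real.rpow_one_add' (by linarith) (by linarith)]
    congr 1
    ring
  rcases le_or_gt |u| 1 with h | h
  · have h1 : (1 + u) ^ (p - 1) ≤ 1 + (p - 1) * u :=
      rpow_one_add_le_one_add_mul_self hu (by linarith) (by linarith)
    have h2 : u ^ 2 ≤ |u| ^ p := by
      rw [← sq_abs, ← Real.rpow_two]
      rcases eq_or_lt_of_le (abs_nonneg u) with h0 | h0
      · rw [← h0, Real.zero_rpow (by norm_num), Real.zero_rpow (by linarith)]
      · exact Real.rpow_le_rpow_of_exponent_ge h0 h hp2
    have h3 : (1 + u) ^ p ≤ (1 + u) * (1 + (p - 1) * u) := by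
      rw [hp']
      exact mul_le_mul_of_nonneg_left h1 (by linarith)
    nlinarith [sq_nonneg u, Real.rpow_nonneg (abs_nonneg u) p]
  · have hu1 : 1 < u := by
      rcases lt_abs.1 h with h1 | h1
      · exact h1
      · linarith
    have h1 : (1 + u) ^ (p - 1) ≤ 1 ^ (p - 1) + u ^ (p - 1) :=
      Real.rpow_add_le_add_rpow zero_le_one (by linarith) (by linarith) (by linarith)
    rw [Real.one_rpow] at h1
    have h2 : u ^ (p - 1) ≤ u ^ p := Real.rpow_le_rpow_of_exponent_le hu1.le (by linarith)
    have h3 : u * u ^ (p - 1) = u ^ p := by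
      rw [← Real.rpow_one_add' (by linarith) (by linarith)]
      congr 1
      ring
    rw [hp', abs_of_pos (by linarith)]
    have h4 : (1 + u) * (1 + u) ^ (p - 1) ≤ (1 + u) * (1 + u ^ (p - 1)) :=
      mul_le_mul_of_nonneg_left h1 (by linarith)
    nlinarith

/-- The moment of a mixture `ε Y + 1 - ε`, when `Y` is a likelihood ratio: only `ε ^ p` enters. -/
lemma lintegral_mixture_rpow_le {Ω : Type*} [MeasurableSpace Ω] (P : Measure Ω)
    [IsProbabilityMeasure P] {Y : Ω → ℝ≥0∞} (hY : Measurable Y) (hY1 : ∫⁻ ω, Y ω ∂P = 1)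
    {ε p M : ℝ} (hε : 0 ≤ ε) (hε1 : ε ≤ 1) (hp : 1 < p) (hp2 : p ≤ 2) (hM : 0 ≤ M)
    (hYp : ∫⁻ ω, Y ω ^ p ∂P ≤ ENNReal.ofReal M) :
    ∫⁻ ω, (ENNReal.ofReal ε * Y ω + ENNReal.ofReal (1 - ε)) ^ p ∂P ≤
      ENNReal.ofReal (1 + 2 * ε ^ p * (1 + M)) := by
  have hp0 : 0 < p := by linarith
  -- The negative part of the first-order term is moved to the left, to stay within `ℝ≥0∞`.
  have hpt : ∀ y : ℝ≥0∞, (ENNReal.ofReal ε * y + ENNReal.ofReal (1 - ε)) ^ p +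
      ENNReal.ofReal (p * ε) ≤ 1 + ENNReal.ofReal (p * ε) * y +
        ENNReal.ofReal (2 * ε ^ p) * (y ^ p + 1) := fun y => by
    rcases eq_or_lt_of_le hε with rfl | hε0
    · simp [Real.zero_rpow hp0.ne']
    cases y with
    | top =>
      have : ENNReal.ofReal (p * ε) ≠ 0 := by simpa using mul_pos hp0 hε0
      simp [ENNReal.mul_top this]
    | coe y =>
      have hy : 0 ≤ (y : ℝ) := y.2
      have h1 := one_add_rpow_le hp hp2 (u := ε * (y - 1)) (by nlinarith)
      have h2 : |ε * ((y : ℝ) - 1)| ^ p ≤ ε ^ p * ((y : ℝ) ^ p + 1) := by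
        rw [abs_mul, abs_of_pos hε0, Real.mul_rpow hε (abs_nonneg _)]
        gcongr
        rcases le_total (y : ℝ) 1 with h | h
        · have : |(y : ℝ) - 1| ^ p ≤ 1 ^ p := by
            gcongr
            rw [abs_le]
            constructor <;> linarith
          rw [Real.one_rpow] at this
          linarith [Real.rpow_nonneg hy p]
        · have : |(y : ℝ) - 1| ^ p ≤ (y : ℝ) ^ p := by
            gcongr
            rw [abs_le]
            constructor <;> linarith
          linarith
      rw [← ENNReal.ofReal_coe_nnreal, ← ENNReal.ofReal_mul hε, ← ENNReal.ofReal_mul (by positivity),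
        ← ENNReal.ofReal_add (by positivity) (by linarith),
        ENNReal.ofReal_rpow_of_nonneg (by have := mul_nonneg hε hy; linarith) hp0.le,
        ENNReal.ofReal_rpow_of_nonneg hy hp0.le, ← ENNReal.ofReal_one,
        ← ENNReal.ofReal_add (by have := mul_nonneg hε hy; positivity) (by positivity),
        ← ENNReal.ofReal_add (by positivity) (by positivity),
        ← ENNReal.ofReal_add (by positivity) (by positivity),
        ← ENNReal.ofReal_mul (by positivity),
        ← ENNReal.ofReal_add (by positivity) (by positivity)]
      refine ENNReal.ofReal_le_ofReal ?_
      have h3 : ε * y + (1 - ε) = 1 + ε * ((y : ℝ) - 1) := by ring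
      rw [h3]
      nlinarith
  have hint := lintegral_mono (μ := P) fun ω => hpt (Y ω)
  rw [lintegral_add_left (by fun_prop), lintegral_const, measure_univ, mul_one,
    lintegral_add_left (by fun_prop), lintegral_add_left (by fun_prop), lintegral_const,
    measure_univ, mul_one, lintegral_const_mul _ hY, hY1, mul_one,
    lintegral_const_mul _ (by fun_prop), lintegral_add_right _ (by fun_prop), lintegral_const,
    measure_univ, mul_one, add_right_comm] at hint
  refine (ENNReal.le_of_add_le_add_right ENNReal.ofReal_ne_top hint).trans ?_
  rw [ENNReal.ofReal_add zero_le_one (by positivity), ENNReal.ofReal_one,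
    ENNReal.ofReal_mul (p := 2 * ε ^ p) (by positivity), add_comm 1 M,
    ENNReal.ofReal_add hM zero_le_one, ENNReal.ofReal_one]
  gcongr

/-- Before the change, the mixture law agrees with the law without a change. -/
lemma mixtureLaw_apply_eq_noChangeLaw {N : ℕ} (Δ : ℝ) {ε : ℝ} (hε : 0 ≤ ε) (hε1 : ε ≤ 1)
    {a : ℕ} {A : Set (Path N)} (hA : MeasurableSet[obsFiltration N a] A) :
    mixtureLaw N Δ ε (a + 1) A = noChangeLaw N A := by
  rw [mixtureLaw_apply_eq_setLIntegral Δ hε hε1 (Nat.le_add_left 1 a) hA]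
  simp [mixtureLR, streamLR, ← ENNReal.ofReal_add hε (sub_nonneg.2 hε1)]

lemma changeLaw_apply_eq_noChangeLaw {N : ℕ} (Δ : ℝ) (S : Finset (Fin N))
    {a : ℕ} {A : Set (Path N)} (hA : MeasurableSet[obsFiltration N a] A) :
    changeLaw N Δ (a + 1) S A = noChangeLaw N A := by
  rw [changeLaw_apply_eq_setLIntegral Δ (Nat.le_add_left 1 a) S hA]
  simp [streamLR]

@[fun_prop]
lemma measurable_mixtureLR {N : ℕ} (Δ ε : ℝ) (a b : ℕ) :
    Measurable (mixtureLR (N := N) Δ ε a b) := by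
  unfold mixtureLR; fun_prop

lemma lintegral_prod_gaussianLR (Δ : ℝ) (a b : ℕ) :
    ∫⁻ x, ∏ i ∈ Finset.Ico a b, gaussianLR Δ (x i)
        ∂(Measure.infinitePi fun _ : ℕ => gaussianReal 0 1) = 1 := by
  simpa using lintegral_prod_gaussianLR_rpow Δ zero_le_one a b

lemma lintegral_mixtureLR_rpow_le {N : ℕ} (Δ : ℝ) {ε p : ℝ} (hε : 0 ≤ ε) (hε1 : ε ≤ 1)
    (hp : 1 < p) (hp2 : p ≤ 2) (a k : ℕ) :
    ∫⁻ ω, mixtureLR Δ ε a (a + k) ω ^ p ∂(noChangeLaw N) ≤ ENNReal.ofReal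
      (Real.exp (N * (2 * ε ^ p * (1 + Real.exp (p * (p - 1) * Δ ^ 2 / 2 * k))))) := by
  simp_rw [mixtureLR, ← ENNReal.prod_rpow_of_nonneg (zero_le_one.trans hp.le)]
  rw [lintegral_prod_streamLR Δ a (a + k) Finset.univ
    (h := fun y => (ENNReal.ofReal ε * y + ENNReal.ofReal (1 - ε)) ^ p) (by fun_prop),
    Finset.card_univ, Fintype.card_fin, Real.exp_nat_mul, ENNReal.ofReal_pow (Real.exp_nonneg _)]
  gcongr
  refine (lintegral_mixture_rpow_le _ (by fun_prop) (lintegral_prod_gaussianLR Δ a (a + k)) hε hε1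
    hp hp2 (Real.exp_nonneg (p * (p - 1) * Δ ^ 2 / 2 * k)) ?_).trans ?_
  · rw [lintegral_prod_gaussianLR_rpow Δ (by linarith)]
    simp
  · refine ENNReal.ofReal_le_ofReal ?_
    rw [add_comm]
    exact Real.add_one_le_exp _

/-- The non-asymptotic bound for the mixture, with a free window length `k` and a free order `p` of
the moment. -/
lemma le_delay {N : ℕ} {Δ ε p γ x : ℝ} (hε : 0 ≤ ε) (hε1 : ε ≤ 1) (hp : 1 < p) (hp2 : p ≤ 2)
    (hγ : 0 < γ) {T : Path N → ℕ∞} (hT : IsStoppingRule T) (harl : ENNReal.ofReal γ ≤ arl T)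
    {k : ℕ} (hk : 1 ≤ k)
    (hx : N * (2 * ε ^ p * (1 + Real.exp (p * (p - 1) * Δ ^ 2 / 2 * k))) ≤ x) :
    ENNReal.ofReal (k * (1 - Real.exp (x / p + Real.log (2 * k / γ) * (1 - 1 / p)))) ≤
      delay Δ ε T := by
  have hTm : ∀ t : ℕ, MeasurableSet {ω | T ω ≤ t} := fun t => (obsFiltration N).le t _ (hT t)
  obtain ⟨a, h0, hwin⟩ := exists_window_le (noChangeLaw N) T hTm hγ harl hk
  have hk0 : (0 : ℝ) < k := by exact_mod_cast hk
  have hAf : MeasurableSet[obsFiltration N a] {ω | T ω ≤ a}ᶜ := (hT a).compl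
  have hBf : MeasurableSet[obsFiltration N (a + k)]
      ({ω | T ω ≤ a}ᶜ ∩ {ω | T ω ≤ (a + k : ℕ)}) :=
    ((obsFiltration N).mono (Nat.le_add_right a k) _ hAf).inter (hT (a + k))
  have : IsProbabilityMeasure (mixtureLaw N Δ ε (a + 1)) := ⟨by
    rw [mixtureLaw_apply_eq_noChangeLaw Δ hε hε1 (@MeasurableSet.univ _ (obsFiltration N a)),
      measure_univ]⟩
  refine (le_condDelay_of_density (mixtureLaw N Δ ε (a + 1)) hT
    (measurable_mixtureLR Δ ε a (a + k)) (mixtureLaw_apply_eq_noChangeLaw Δ hε hε1 hAf)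
    (mixtureLaw_apply_eq_setLIntegral Δ hε hε1 (Nat.le_add_left 1 a) hBf) hp ?_ h0
    (by rwa [Real.exp_log (by positivity)])).trans
    (le_iSup₂_of_le (a + 1) (Nat.le_add_left 1 a) le_rfl)
  rw [setLIntegral_eq_mul_of_measurable_future hAf]
  · gcongr
    exact (lintegral_mixtureLR_rpow_le Δ hε hε1 hp hp2 a k).trans
      (ENNReal.ofReal_le_ofReal (Real.exp_le_exp.2 hx))
  · refine Measurable.pow_const ?_ p
    unfold mixtureLR
    refine @Finset.measurable_fun_prod _ _ _ _ _ _ (_) _ _ fun n _ => ?_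
    exact ((measurable_future_streamLR Δ a (a + k) n).const_mul _).add_const _

/-- The non-asymptotic bound for sets of exactly `V` changing streams. A set of this size exists
because of `V ≤ N`. -/
lemma le_delayOfSize {N : ℕ} {Δ p γ x : ℝ} (hp : 1 < p) {V : ℕ} (hV : V ≤ N)
    (hγ : 0 < γ) {T : Path N → ℕ∞} (hT : IsStoppingRule T) (harl : ENNReal.ofReal γ ≤ arl T)
    {k : ℕ} (hk : 1 ≤ k) (hx : V * (p * (p - 1) * Δ ^ 2 / 2 * k) ≤ x) :
    ENNReal.ofReal (k * (1 - Real.exp (x / p + Real.log (2 * k / γ) * (1 - 1 / p)))) ≤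
      delayOfSize Δ V T := by
  have hTm : ∀ t : ℕ, MeasurableSet {ω | T ω ≤ t} := fun t => (obsFiltration N).le t _ (hT t)
  obtain ⟨a, h0, hwin⟩ := exists_window_le (noChangeLaw N) T hTm hγ harl hk
  obtain ⟨S, -, hS⟩ := Finset.exists_subset_card_eq (s := (Finset.univ : Finset (Fin N)))
    (by simpa using hV)
  have hk0 : (0 : ℝ) < k := by exact_mod_cast hk
  have hAf : MeasurableSet[obsFiltration N a] {ω | T ω ≤ a}ᶜ := (hT a).compl
  have hBf : MeasurableSet[obsFiltration N (a + k)]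
      ({ω | T ω ≤ a}ᶜ ∩ {ω | T ω ≤ (a + k : ℕ)}) :=
    ((obsFiltration N).mono (Nat.le_add_right a k) _ hAf).inter (hT (a + k))
  refine (le_condDelay_of_density (changeLaw N Δ (a + 1) S) hT
    (L := fun ω => ∏ n ∈ S, streamLR Δ a (a + k) n ω)
    (by fun_prop) (changeLaw_apply_eq_noChangeLaw Δ S hAf)
    (changeLaw_apply_eq_setLIntegral Δ (Nat.le_add_left 1 a) S hBf) hp ?_ h0
    (by rwa [Real.exp_log (by positivity)])).trans
    (le_iSup₂_of_le (a + 1) (Nat.le_add_left 1 a) (le_iSup₂_of_le S hS le_rfl))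
  rw [setLIntegral_eq_mul_of_measurable_future hAf]
  · gcongr
    simp_rw [← ENNReal.prod_rpow_of_nonneg (zero_le_one.trans hp.le)]
    rw [lintegral_prod_streamLR Δ a (a + k) S (h := fun y => y ^ p) (by fun_prop), hS,
      lintegral_prod_gaussianLR_rpow Δ (by linarith), ← ENNReal.ofReal_pow (Real.exp_nonneg _),
      ← Real.exp_nat_mul]
    refine ENNReal.ofReal_le_ofReal (Real.exp_le_exp.2 ?_)
    simpa using hx
  · refine Measurable.pow_const ?_ p
    exact @Finset.measurable_fun_prod _ _ _ _ _ _ (_) _ _ fun n _ =>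
      measurable_future_streamLR Δ a (a + k) n

/-! ### Asymptotics -/

lemma rhoZ_pos {β ζ : ℝ} (h1 : (1 - ζ) / 2 < β) (h2 : β < 1 - ζ) : 0 < rhoZ β ζ := by
  rw [rhoZ]
  split_ifs with h
  · linarith
  · have : √(1 - ζ - β) < √(1 - ζ) := Real.sqrt_lt_sqrt (by linarith) (by linarith)
    exact pow_pos (by linarith) 2

/-- The role of `rhoZ`: below it, some order `p ∈ (1, 2]` makes `N * ε ^ p * E Y ^ p`, which is
`N ^ (1 - p * β + p * (p - 1) * ρ)`, of smaller order than `N ^ ζ`. For `β ≤ 3 (1 - ζ) / 4` the best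
order is `2`; otherwise it is `√(1 - ζ) / (√(1 - ζ) - √(1 - ζ - β))`, for which there is equality
at `ρ = rhoZ β ζ`. -/
lemma exists_order_of_lt_rhoZ {β ζ ρ : ℝ} (h2 : β < 1 - ζ)
    (hρ : ρ < rhoZ β ζ) : ∃ p, 1 < p ∧ p ≤ 2 ∧ 1 - ζ + p * (p - 1) * ρ < p * β := by
  rw [rhoZ] at hρ
  split_ifs at hρ with h
  · exact ⟨2, by norm_num, le_rfl, by linarith⟩
  · set a := √(1 - ζ) with ha
    set c := √(1 - ζ - β) with hc
    have ha2 : a ^ 2 = 1 - ζ := Real.sq_sqrt (by linarith)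
    have hc2 : c ^ 2 = 1 - ζ - β := Real.sq_sqrt (by linarith)
    have hc0 : 0 < c := Real.sqrt_pos.2 (by linarith)
    have ha0 : 0 < a := Real.sqrt_pos.2 (by linarith)
    have hca : 2 * c ≤ a := by
      refine (sq_le_sq₀ (by positivity) ha0.le).1 ?_
      nlinarith
    have hr : 0 < a - c := by linarith
    have hp1 : 1 < a / (a - c) := by rw [lt_div_iff₀ hr]; linarith
    refine ⟨a / (a - c), hp1, by rw [div_le_iff₀ hr]; linarith, ?_⟩
    have hβ : β = a ^ 2 - c ^ 2 := by linarith
    have key : a ^ 2 + a / (a - c) * (a / (a - c) - 1) * (a - c) ^ 2 = a / (a - c) * β := by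
      rw [hβ]
      field_simp
      ring
    rw [← ha2, ← key]
    have : 0 < a / (a - c) * (a / (a - c) - 1) := mul_pos (by linarith) (by linarith)
    linarith [mul_lt_mul_of_pos_left hρ this]

/-- The passage to the limit. Here `s` is the scale of `log γ` and `b` that of the delay. The condition
`θ < p - 1` makes the moment `exp (θ * s)` smaller than `γ ^ (p - 1)` by an exponential factor, so
that the error probability tends to zero and the delay is at least `(1 + o(1)) * k`. -/
lemma le_liminf_of_eventually_le {D : ℕ → ℝ≥0∞} {V k : ℕ → ℕ} {b s γ : ℕ → ℝ} {p θ κ C : ℝ}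
    (hp : 1 < p) (hθ : θ < p - 1) (hC : 0 < C) (hb : ∀ᶠ N in atTop, 0 < b N)
    (hs : Tendsto s atTop atTop) (hγ : ∀ N, 1 ≤ γ N)
    (hγs : Tendsto (fun N => Real.log (γ N) / s N) atTop (𝓝 1))
    (hk : ∀ᶠ N in atTop, 1 ≤ k N ∧ (k N : ℝ) ≤ C * s N)
    (hκ : Tendsto (fun N => V N * k N / b N) atTop (𝓝 κ))
    (hD : ∀ᶠ N in atTop, ENNReal.ofReal (k N * (1 - Real.exp (θ * s N / p +
      Real.log (2 * k N / γ N) * (1 - 1 / p)))) ≤ D N) :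
    ENNReal.ofReal κ ≤ liminf (fun N => (V N : ℝ≥0∞) * (D N / ENNReal.ofReal (b N))) atTop := by
  have hp0 : 0 < p := by linarith
  have hp' : 0 < 1 - 1 / p := by rw [sub_pos, div_lt_one hp0]; exact hp
  set e : ℕ → ℝ := fun N => θ * s N / p + Real.log (2 * k N / γ N) * (1 - 1 / p) with he
  have hlog : Tendsto (fun N => Real.log (2 * C * s N) / s N) atTop (𝓝 0) := by
    have h1 : Tendsto (fun N => 2 * C * s N) atTop atTop := hs.const_mul_atTop (by positivity)
    have h2 := (Real.isLittleO_log_id_atTop.tendsto_div_nhds_zero.comp h1).const_mul (2 * C)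
    rw [mul_zero] at h2
    refine h2.congr' ?_
    filter_upwards [hs.eventually_gt_atTop 0] with N hN
    simp only [Function.comp, id]
    field_simp
  have hebot : Tendsto e atTop atBot := by
    have h1 : Tendsto (fun N => θ / p + (Real.log (2 * C * s N) / s N - Real.log (γ N) / s N) *
        (1 - 1 / p)) atTop (𝓝 (θ / p + (0 - 1) * (1 - 1 / p))) :=
      ((hlog.sub hγs).mul_const _).const_add _
    have h2 : θ / p + (0 - 1) * (1 - 1 / p) < 0 := by
      have : θ / p + (0 - 1) * (1 - 1 / p) = (θ - (p - 1)) / p := by field_simp; ring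
      rw [this]
      exact div_neg_of_neg_of_pos (by linarith) hp0
    refine tendsto_atBot_mono' _ ?_ (h1.neg_mul_atTop h2 hs)
    filter_upwards [hk, hs.eventually_gt_atTop 0] with N hN hsN
    have hk0 : (0 : ℝ) < k N := by exact_mod_cast hN.1
    have h3 : Real.log (2 * k N / γ N) ≤ Real.log (2 * C * s N) - Real.log (γ N) := by
      rw [Real.log_div (by positivity) (by have := hγ N; positivity)]
      gcongr ?_ - _
      exact Real.log_le_log (by positivity) (by linarith [hN.2])
    calc e N ≤ θ * s N / p + (Real.log (2 * C * s N) - Real.log (γ N)) * (1 - 1 / p) := by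
          simp only [he]; gcongr
      _ = _ := by field_simp
  have hlim : Tendsto (fun N => ENNReal.ofReal (V N * k N / b N * (1 - Real.exp (e N)))) atTop
      (𝓝 (ENNReal.ofReal κ)) := by
    refine ENNReal.tendsto_ofReal ?_
    simpa using hκ.mul ((Real.tendsto_exp_atBot.comp hebot).const_sub 1)
  rw [← hlim.liminf_eq]
  refine liminf_le_liminf ?_
  filter_upwards [hb, hD] with N hbN hDN
  have h1 : (V N : ℝ) * k N / b N * (1 - Real.exp (e N)) =
      V N * (k N * (1 - Real.exp (e N)) / b N) := by ring
  rw [h1, ENNReal.ofReal_mul (by positivity), ENNReal.ofReal_natCast,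
    ENNReal.ofReal_div_of_pos hbN]
  gcongr

lemma tendsto_natCast_rpow_atTop {ζ : ℝ} (hζ : 0 < ζ) :
    Tendsto (fun N : ℕ => (N : ℝ) ^ ζ) atTop atTop :=
  (tendsto_rpow_atTop hζ).comp tendsto_natCast_atTop_atTop

lemma tendsto_log_natCast_atTop : Tendsto (fun N : ℕ => Real.log N) atTop atTop :=
  Real.tendsto_log_atTop.comp tendsto_natCast_atTop_atTop

lemma tendsto_div_rpow_of_isEquivalent {ζ : ℝ} {f : ℕ → ℝ}
    (h : f ~[atTop] fun N : ℕ => (N : ℝ) ^ ζ) :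
    Tendsto (fun N : ℕ => f N / (N : ℝ) ^ ζ) atTop (𝓝 1) := by
  refine (isEquivalent_iff_tendsto_one ?_).1 h
  filter_upwards [eventually_gt_atTop 0] with N hN
  have : (0 : ℝ) < N := by exact_mod_cast hN
  positivity

/-- The window length is `k ~ 2 ρ Δ⁻² log N`, for which `exp (k Δ ^ 2 / 2)` is about `N ^ ρ`. -/
lemma le_liminf_delay {Δ ζ β ρ : ℝ} (hΔ : Δ ≠ 0) (hζ : 0 < ζ) {ε γ : ℕ → ℝ}
    (hε : ∀ᶠ N in atTop, 0 < ε N ∧ ε N < 1) (hεβ : ε ~[atTop] fun N : ℕ => (N : ℝ) ^ (-β))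
    (hγ : ∀ N, 1 ≤ γ N)
    (hγζ : (fun N : ℕ => Real.log (γ N)) ~[atTop] fun N : ℕ => (N : ℝ) ^ ζ)
    {T : (N : ℕ) → Path N → ℕ∞} (hT : ∀ N, IsStoppingRule (T N))
    (hARL : ∀ N, ENNReal.ofReal (γ N) ≤ arl (T N))
    (h1 : (1 - ζ) / 2 < β) (h2 : β < 1 - ζ) (hρ0 : 0 < ρ) (hρ : ρ < rhoZ β ζ) :
    ENNReal.ofReal (2 / Δ ^ 2 * ρ) ≤
      liminf (fun N : ℕ => delay Δ (ε N) (T N) / ENNReal.ofReal (Real.log N)) atTop := by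
  obtain ⟨p, hp, hp2, hpρ⟩ := exists_order_of_lt_rhoZ h2 hρ
  have hΔ2 : 0 < Δ ^ 2 := by positivity
  have hκ0 : 0 < 2 / Δ ^ 2 * ρ := by positivity
  have hlog := tendsto_log_natCast_atTop
  have hfloor := (tendsto_nat_floor_mul_div_atTop hκ0.le).comp hlog
  have hm := le_liminf_of_eventually_le (D := fun N => delay Δ (ε N) (T N)) (V := fun _ => 1)
    (k := fun N => ⌊2 / Δ ^ 2 * ρ * Real.log N⌋₊) (b := fun N => Real.log N)
    (s := fun N => (N : ℝ) ^ ζ) (γ := γ) (p := p) (θ := (p - 1) / 2) (κ := 2 / Δ ^ 2 * ρ)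
    (C := 2 / Δ ^ 2 * ρ / ζ) hp (by linarith) (by positivity) (hlog.eventually_gt_atTop 0)
    (tendsto_natCast_rpow_atTop hζ) hγ (tendsto_div_rpow_of_isEquivalent hγζ) ?_
    (by simpa [Function.comp_def] using hfloor) ?_
  · simpa using hm
  · filter_upwards [(hlog.const_mul_atTop hκ0).eventually_ge_atTop 1] with N hN
    refine ⟨Nat.le_floor (by simpa using hN), (Nat.floor_le (by linarith)).trans ?_⟩
    exact (mul_le_mul_of_nonneg_left (Real.log_le_rpow_div (Nat.cast_nonneg N) hζ)
      hκ0.le).trans_eq (by ring)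
  · set η := ζ - (1 - p * β + p * (p - 1) * ρ) with hη
    have hη0 : 0 < η := by linarith
    have hsmall : ∀ᶠ N : ℕ in atTop, (N : ℝ) ^ (-η) ≤ (p - 1) / 2 / (4 * 2 ^ p) :=
      ((tendsto_rpow_neg_atTop hη0).comp tendsto_natCast_atTop_atTop).eventually_le_const
        (div_pos (by linarith) (by positivity))
    filter_upwards [hε, (tendsto_div_rpow_of_isEquivalent hεβ).eventually_le_const one_lt_two,
      (hlog.const_mul_atTop hκ0).eventually_ge_atTop 1, hlog.eventually_gt_atTop 0,
      eventually_gt_atTop 0, hsmall] with N hεN hε2 hkN hlogN hN hsm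
    have hN0 : (0 : ℝ) < N := by exact_mod_cast hN
    refine le_delay hεN.1.le hεN.2.le hp hp2 (by linarith [hγ N]) (hT N) (hARL N)
      (Nat.le_floor (by simpa using hkN)) ?_
    rw [div_le_iff₀ (by positivity)] at hε2
    have hexp : Real.exp (p * (p - 1) * Δ ^ 2 / 2 * ⌊2 / Δ ^ 2 * ρ * Real.log N⌋₊) ≤
        (N : ℝ) ^ (p * (p - 1) * ρ) := by
      rw [Real.rpow_def_of_pos hN0]
      refine Real.exp_le_exp.2 ?_
      have hpp : 0 ≤ p * (p - 1) * Δ ^ 2 / 2 := by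
        have := mul_pos (by linarith : 0 < p) (by linarith : 0 < p - 1)
        positivity
      refine (mul_le_mul_of_nonneg_left (Nat.floor_le (by linarith)) hpp).trans_eq ?_
      field_simp
    have hone : 1 ≤ (N : ℝ) ^ (p * (p - 1) * ρ) := by
      refine Real.one_le_rpow (by exact_mod_cast hN) ?_
      have := mul_pos (by linarith : 0 < p) (by linarith : 0 < p - 1)
      positivity
    calc (N : ℝ) * (2 * ε N ^ p *
          (1 + Real.exp (p * (p - 1) * Δ ^ 2 / 2 * ⌊2 / Δ ^ 2 * ρ * Real.log N⌋₊)))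
        ≤ N * (2 * (2 * (N : ℝ) ^ (-β)) ^ p *
          ((N : ℝ) ^ (p * (p - 1) * ρ) + (N : ℝ) ^ (p * (p - 1) * ρ))) := by
          have := hεN.1
          gcongr
      _ = 4 * 2 ^ p * ((N : ℝ) ^ (1 : ℝ) * (N : ℝ) ^ (-β * p) * (N : ℝ) ^ (p * (p - 1) * ρ)) := by
          rw [Real.mul_rpow (by norm_num) (by positivity), ← Real.rpow_mul hN0.le, Real.rpow_one]
          ring
      _ = 4 * 2 ^ p * ((N : ℝ) ^ (-η) * (N : ℝ) ^ ζ) := by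
          rw [← Real.rpow_add hN0, ← Real.rpow_add hN0, ← Real.rpow_add hN0]
          congr 2
          rw [hη]
          ring
      _ ≤ 4 * 2 ^ p * ((p - 1) / 2 / (4 * 2 ^ p) * (N : ℝ) ^ ζ) := by gcongr
      _ = (p - 1) / 2 * (N : ℝ) ^ ζ := by field_simp

/-- The window length is `k ~ 2 (1 - δ) Δ⁻² N ^ ζ / V`. The order `p = 1 + δ` is admissible because of
`p (1 - δ) < 1`. -/
lemma le_liminf_delayOfSize {Δ ζ δ : ℝ} (hΔ : Δ ≠ 0) (hζ : 0 < ζ) (hζ1 : ζ ≤ 1) {γ : ℕ → ℝ}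
    (hγ : ∀ N, 1 ≤ γ N)
    (hγζ : (fun N : ℕ => Real.log (γ N)) ~[atTop] fun N : ℕ => (N : ℝ) ^ ζ)
    {T : (N : ℕ) → Path N → ℕ∞} (hT : ∀ N, IsStoppingRule (T N))
    (hARL : ∀ N, ENNReal.ofReal (γ N) ≤ arl (T N)) {V : ℕ → ℕ} (hV : ∀ N, 1 ≤ V N)
    (hVo : (fun N : ℕ => (V N : ℝ)) =o[atTop] (fun N : ℕ => (N : ℝ) ^ ζ / Real.log N))
    (hδ : 0 < δ) (hδ1 : δ < 1) :
    ENNReal.ofReal (2 / Δ ^ 2 * (1 - δ)) ≤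
      liminf (fun N : ℕ => (V N : ℝ≥0∞) *
        (delayOfSize Δ (V N) (T N) / ENNReal.ofReal ((N : ℝ) ^ ζ))) atTop := by
  have hΔ2 : 0 < Δ ^ 2 := by positivity
  have hδ' : 0 < 1 - δ := by linarith
  set κ := 2 / Δ ^ 2 * (1 - δ) with hκ
  have hκ0 : 0 < κ := by positivity
  have hlog := tendsto_log_natCast_atTop
  have hV0 : ∀ N, (0 : ℝ) < V N := fun N => by exact_mod_cast hV N
  have hVle : ∀ᶠ N : ℕ in atTop, (V N : ℝ) ≤ (N : ℝ) ^ ζ / Real.log N := by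
    filter_upwards [hVo.bound one_pos, hlog.eventually_gt_atTop 0] with N h h0
    rw [one_mul, Real.norm_of_nonneg (hV0 N).le, Real.norm_of_nonneg (by positivity)] at h
    exact h
  have hx : Tendsto (fun N : ℕ => (N : ℝ) ^ ζ / V N) atTop atTop := by
    refine tendsto_atTop_mono' _ ?_ hlog
    filter_upwards [hVle, hlog.eventually_gt_atTop 0] with N h h0
    rw [le_div_iff₀ h0] at h
    rw [le_div_iff₀ (hV0 N)]
    linarith
  refine le_liminf_of_eventually_le (D := fun N => delayOfSize Δ (V N) (T N)) (V := V)
    (k := fun N => ⌊κ * ((N : ℝ) ^ ζ / V N)⌋₊) (b := fun N => (N : ℝ) ^ ζ)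
    (s := fun N => (N : ℝ) ^ ζ) (γ := γ) (p := 1 + δ) (θ := δ * ((1 + δ) * (1 - δ)))
    (C := κ) (by linarith) (by nlinarith [mul_pos hδ (mul_pos hδ hδ)]) hκ0
    ((tendsto_natCast_rpow_atTop hζ).eventually_gt_atTop 0)
    (tendsto_natCast_rpow_atTop hζ) hγ (tendsto_div_rpow_of_isEquivalent hγζ) ?_ ?_ ?_
  · filter_upwards [(hx.const_mul_atTop hκ0).eventually_ge_atTop 1] with N hN
    refine ⟨Nat.le_floor (by simpa using hN), (Nat.floor_le (by linarith)).trans ?_⟩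
    gcongr
    exact div_le_self (by positivity) (by exact_mod_cast hV N)
  · refine ((tendsto_nat_floor_mul_div_atTop hκ0.le).comp hx).congr fun N => ?_
    simp only [Function.comp]
    rw [div_div_eq_mul_div, mul_comm]
  · filter_upwards [(hx.const_mul_atTop hκ0).eventually_ge_atTop 1, hVle,
      hlog.eventually_ge_atTop 1, eventually_ge_atTop 1] with N hkN hVN hlogN hN
    have hVN' : V N ≤ N := by
      have h1 : (V N : ℝ) ≤ N := by
        refine hVN.trans ((div_le_self (by positivity) hlogN).trans ?_)
        exact (Real.rpow_le_rpow_of_exponent_le (by exact_mod_cast hN) hζ1).trans_eq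
          (Real.rpow_one _)
      exact_mod_cast h1
    refine le_delayOfSize (by linarith) hVN' (by linarith [hγ N]) (hT N) (hARL N)
      (Nat.le_floor (by simpa using hkN)) ?_
    have hfl := Nat.floor_le (a := κ * ((N : ℝ) ^ ζ / V N)) (by linarith)
    have hc : 0 ≤ (1 + δ) * (1 + δ - 1) * Δ ^ 2 / 2 := by
      have : 0 < 1 + δ - 1 := by linarith
      positivity
    refine (mul_le_mul_of_nonneg_left (mul_le_mul_of_nonneg_left hfl hc) (hV0 N).le).trans_eq ?_
    have := (hV0 N).ne'
    rw [hκ]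
    field_simp
    ring

end SeqDetect

theorem theorem1 (Δ ζ β : ℝ) (hΔ : Δ ≠ 0) (hζ : 0 < ζ) (hζ1 : ζ ≤ 1) (hβ : 0 < β) (hβ1 : β < 1)
    (ε γ : ℕ → ℝ) (hε : ∀ᶠ N in atTop, 0 < ε N ∧ ε N < 1)
    (hεβ : ε ~[atTop] fun N : ℕ => (N : ℝ) ^ (-β))
    (hγ : ∀ N, 1 ≤ γ N)
    (hγζ : (fun N : ℕ => Real.log (γ N)) ~[atTop] fun N : ℕ => (N : ℝ) ^ ζ)
    (T : (N : ℕ) → SeqDetect.Path N → ℕ∞)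
    (hT : ∀ N, SeqDetect.IsStoppingRule (T N))
    (hARL : ∀ N, ENNReal.ofReal (γ N) ≤ SeqDetect.arl (T N)) :
    ((1 - ζ) / 2 < β → β < 1 - ζ →
      ENNReal.ofReal (2 / Δ ^ 2 * SeqDetect.rhoZ β ζ) ≤
        liminf (fun N : ℕ =>
          SeqDetect.delay Δ (ε N) (T N) / ENNReal.ofReal (Real.log N)) atTop) ∧
    (1 - ζ < β → ∀ V : ℕ → ℕ, (∀ N, 1 ≤ V N) →
      (fun N : ℕ => (V N : ℝ)) =o[atTop] (fun N : ℕ => (N : ℝ) ^ ζ / Real.log N) →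
      ENNReal.ofReal (2 / Δ ^ 2) ≤
        liminf (fun N : ℕ =>
          (V N : ℝ≥0∞) * (SeqDetect.delayOfSize Δ (V N) (T N) /
            ENNReal.ofReal ((N : ℝ) ^ ζ))) atTop) := by
  refine ⟨fun h1 h2 => ?_, fun _ V hV hVo => ?_⟩
  · have hlim : Tendsto (fun ρ : ℝ => ENNReal.ofReal (2 / Δ ^ 2 * ρ))
        (𝓝[<] (SeqDetect.rhoZ β ζ)) (𝓝 (ENNReal.ofReal (2 / Δ ^ 2 * SeqDetect.rhoZ β ζ))) :=
      (ENNReal.tendsto_ofReal (tendsto_id.const_mul _)).mono_left nhdsWithin_le_nhds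
    refine le_of_tendsto hlim ?_
    filter_upwards [Ioo_mem_nhdsLT (SeqDetect.rhoZ_pos h1 h2)] with ρ hρ
    exact SeqDetect.le_liminf_delay hΔ hζ hε hεβ hγ hγζ hT hARL h1 h2 hρ.1 hρ.2
  · have hlim : Tendsto (fun δ : ℝ => ENNReal.ofReal (2 / Δ ^ 2 * (1 - δ)))
        (𝓝[>] 0) (𝓝 (ENNReal.ofReal (2 / Δ ^ 2))) := by
      refine Tendsto.mono_left ?_ nhdsWithin_le_nhds
      refine ENNReal.tendsto_ofReal ?_
      simpa using ((tendsto_id (x := 𝓝 (0 : ℝ))).const_sub 1).const_mul (2 / Δ ^ 2)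
    refine le_of_tendsto hlim ?_
    filter_upwards [Ioo_mem_nhdsGT one_pos] with δ hδ
    exact SeqDetect.le_liminf_delayOfSize hΔ hζ hζ1 hγ hγζ hT hARL hV hVo hδ.1 hδ.2
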